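/- **Proposition.** Write $P_2(\mathbb R^n)$ for the Borel probability measures on $\mathbb R^n$ with finite second moment and $W_2$ for the quadratic Wasserstein distance. Let $\varphi$ be a convex function on $\mathbb R^n$ and let $\mu$ and $\nu=\nabla\varphi\#\mu$ be absolutely continuous with respect to Lebesgue measure. Put $$ J_{0,W}(\nu|\mu)=\int_{\mathbb R^n}\big(\Delta\varphi(x)+\Delta\varphi^*(\nabla\varphi(x))-2n\big)\,d\mu(x) +\frac12\iint_{\mathbb R^{2n}}\big(\nabla W(\nabla\varphi(x)-\nabla\varphi(y))-\nabla W(x-y)\big)\cdot\big(\nabla\varphi(x)-\nabla\varphi(y)-(x-y)\big)\,d\mu(x)\,d\mu(y), $$ where $\varphi^*$ is the Legendre transform of $\varphi$ and $\Delta$ is the trace of the Hessian in the Alexandrov sense. Each integral is read as an extended real number (integral of the positive part minus integral of the negative part). Let $K>0$ and $R,M\in\mathbb R$, and put $$ C=2\Big(\frac6K+4R^2\,\big|B(0,2R)\big|\,e^{M}\Big)^{-1}>0, $$ where $|B(0,2R)|$ is the Lebesgue measure of the closed ball of radius $2R$ in $\mathbb R^n$ (zero if $R<0$); thus $C$ depends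 only on $n,K,R,M$. Let $W$ be a $C^2$ convex function on $\mathbb R^n$ with $\nabla^2W(x)\ge K$ (as a quadratic form) whenever $|x|\ge R$. Let $\mu\in P_2(\mathbb R^n)$ have a density $e^{-U}$ with $U:\mathbb R^n\to\mathbb R$ continuous and $$ \sup_{|x-y|\le 2R}\ \sup_{z\in[x,y]}\{U(z)-U(x)-U(y)\}\le M . $$ Then $$ C\,W_2^2(\nu,\mu)\le J_{0,W}(\nu|\mu) $$ for every absolutely continuous $\nu\in P_2(\mathbb R^n)$ with the same center of mass as $\mu$ that is of the form $\nu=\nabla\varphi\#\mu$ with $\varphi$ convex and of class $C^2$ on $\mathbb R^n$. -/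

import Mathlib

open MeasureTheory Filter Topology Asymptotics
open scoped ENNReal RealInnerProductSpace

noncomputable section

/-- `P₂(ℝⁿ)`: Borel probability measures with finite second moment. -/
def IsP2 {n : ℕ} (μ : Measure (EuclideanSpace ℝ (Fin n))) : Prop :=
  IsProbabilityMeasure μ ∧ Integrable (fun x => ‖x‖ ^ 2) μ

/-- The quadratic Wasserstein distance (an infimum over all couplings of `μ` and `ν`). -/
def W2 {n : ℕ} (μ ν : Measure (EuclideanSpace ℝ (Fin n))) : ℝ≥0∞ :=
  ⨅ (π : Measure (EuclideanSpace ℝ (Fin n) × EuclideanSpace ℝ (Fin n)))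
    (_ : π.map Prod.fst = μ ∧ π.map Prod.snd = ν),
    (∫⁻ p, ‖p.1 - p.2‖ₑ ^ 2 ∂π) ^ (1 / 2 : ℝ)

/-- `f` has Alexandrov Hessian `A` (a symmetric operator) at `x`: a second order expansion
`f (x + h) = f x + p · h + (A h) · h / 2 + o(|h|²)` holds for some vector `p`. -/
def HasAlexandrovHessianAt {n : ℕ} (f : EuclideanSpace ℝ (Fin n) → ℝ)
    (A : EuclideanSpace ℝ (Fin n) →ₗ[ℝ] EuclideanSpace ℝ (Fin n))
    (x : EuclideanSpace ℝ (Fin n)) : Prop :=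
  A.IsSymmetric ∧ ∃ p : EuclideanSpace ℝ (Fin n),
    (fun h => f (x + h) - f x - ⟪p, h⟫ - ⟪A h, h⟫ / 2) =o[𝓝 0] (fun h => ‖h‖ ^ 2)

/-- The Alexandrov Hessian is unique. -/
theorem HasAlexandrovHessianAt.unique {n : ℕ} {f : EuclideanSpace ℝ (Fin n) → ℝ}
    {A B : EuclideanSpace ℝ (Fin n) →ₗ[ℝ] EuclideanSpace ℝ (Fin n)}
    {x : EuclideanSpace ℝ (Fin n)} (hA : HasAlexandrovHessianAt f A x)
    (hB : HasAlexandrovHessianAt f B x) : A = B := by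
  obtain ⟨sA, p, hp⟩ := hA
  obtain ⟨sB, q, hq⟩ := hB
  have hneg : Tendsto (fun h : EuclideanSpace ℝ (Fin n) => -h) (𝓝 0) (𝓝 0) := by
    have : Continuous fun h : EuclideanSpace ℝ (Fin n) => -h := continuous_neg
    simpa using this.tendsto 0
  have h1 := hq.sub hp
  have h2 := h1.comp_tendsto hneg
  have h3 : (fun h => ⟪(A - B) h, h⟫) =o[𝓝 0]
      (fun h : EuclideanSpace ℝ (Fin n) => ‖h‖ ^ 2) := by
    have h2' : ((fun h => (f (x + h) - f x - ⟪q, h⟫ - ⟪B h, h⟫ / 2) -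
        (f (x + h) - f x - ⟪p, h⟫ - ⟪A h, h⟫ / 2)) ∘ fun h => -h) =o[𝓝 0]
      (fun h : EuclideanSpace ℝ (Fin n) => ‖h‖ ^ 2) := by
      refine h2.congr_right ?_
      intro h
      simp
    refine (h1.add h2').congr_left ?_
    intro h
    simp [inner_sub_left]
    ring
  have h4 : ∀ v, ⟪(A - B) v, v⟫ = 0 := by
    intro v
    have ht : Tendsto (fun t : ℝ => t • v) (𝓝[≠] 0) (𝓝 0) := by
      have : Continuous fun t : ℝ => t • v := by fun_prop
      simpa using (this.tendsto 0).mono_left nhdsWithin_le_nhds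
    have h5 := h3.comp_tendsto ht
    have h6 : (fun t : ℝ => t ^ 2 * ⟪(A - B) v, v⟫) =o[𝓝[≠] 0]
        (fun t : ℝ => t ^ 2 * ‖v‖ ^ 2) := by
      refine (h5.congr_left ?_).congr_right ?_
      · intro t
        simp only [Function.comp, map_smul, inner_smul_left, inner_smul_right]
        simp
        ring
      · intro t
        simp [norm_smul, mul_pow]
    have h7 : (fun t : ℝ => t ^ 2 * ⟪(A - B) v, v⟫) =o[𝓝[≠] 0] (fun t : ℝ => t ^ 2) := by
      refine h6.trans_isBigO ?_
      exact IsBigO.of_bound (‖v‖ ^ 2) (Eventually.of_forall fun t => by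
        simp [mul_comm])
    have h8 : Tendsto (fun _ : ℝ => ⟪(A - B) v, v⟫) (𝓝[≠] 0) (𝓝 0) := by
      refine h7.tendsto_div_nhds_zero.congr' ?_
      filter_upwards [self_mem_nhdsWithin] with t ht
      have : t ≠ 0 := ht
      field_simp
    exact tendsto_nhds_unique tendsto_const_nhds h8
  have h9 : A - B = 0 := ((sA.sub sB).inner_map_self_eq_zero).1 h4
  exact sub_eq_zero.1 h9

open Classical in
/-- The Alexandrov Laplacian `Δf (x)`: the trace of the Alexandrov Hessian of `f` at `x`
(the value `0` is assigned at the points without a Hessian, which form a null set for convex `f`). -/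
def alexandrovLaplacian {n : ℕ} (f : EuclideanSpace ℝ (Fin n) → ℝ)
    (x : EuclideanSpace ℝ (Fin n)) : ℝ :=
  if h : ∃ A, HasAlexandrovHessianAt f A x then LinearMap.trace ℝ _ h.choose else 0

theorem HasAlexandrovHessianAt.laplacian_eq {n : ℕ} {f : EuclideanSpace ℝ (Fin n) → ℝ}
    {A : EuclideanSpace ℝ (Fin n) →ₗ[ℝ] EuclideanSpace ℝ (Fin n)}
    {x : EuclideanSpace ℝ (Fin n)} (hA : HasAlexandrovHessianAt f A x) :
    alexandrovLaplacian f x = LinearMap.trace ℝ _ A := by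
  have h : ∃ A, HasAlexandrovHessianAt f A x := ⟨A, hA⟩
  rw [alexandrovLaplacian, dif_pos h, h.choose_spec.unique hA]

/-- The Legendre transform `φ*(y) = sup_x (x · y - φ(x))`. (Where the supremum is infinite the
real-valued supremum is `0`; the measure `∇φ # μ` only sees the domain of `φ*`, and its interior
when it is absolutely continuous.) -/
def legendre {n : ℕ} (φ : EuclideanSpace ℝ (Fin n) → ℝ) (y : EuclideanSpace ℝ (Fin n)) : ℝ :=
  ⨆ x, (⟪x, y⟫ - φ x)

/-- `φ` is a convex function whose gradient pushes `μ` forward to `ν`. -/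
def IsBrenierPotential {n : ℕ} (φ : EuclideanSpace ℝ (Fin n) → ℝ)
    (μ ν : Measure (EuclideanSpace ℝ (Fin n))) : Prop :=
  ConvexOn ℝ Set.univ φ ∧ μ.map (gradient φ) = ν

/-- The integral of a real function as an extended real number, `∫ f⁺ - ∫ f⁻`. -/
def extIntegral {α : Type*} [MeasurableSpace α] (μ : Measure α) (f : α → ℝ) : EReal :=
  ((∫⁻ x, ENNReal.ofReal (f x) ∂μ : ℝ≥0∞) : EReal) -
    ((∫⁻ x, ENNReal.ofReal (-f x) ∂μ : ℝ≥0∞) : EReal)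

/-- The dissipation functional `J_{V,W}(ν | μ)` of absolutely continuous `μ` and `ν = ∇φ # μ`,
written in terms of the convex function `φ`. -/
def dissipationJ {n : ℕ} (V W : EuclideanSpace ℝ (Fin n) → ℝ)
    (φ : EuclideanSpace ℝ (Fin n) → ℝ) (μ : Measure (EuclideanSpace ℝ (Fin n))) : EReal :=
  extIntegral μ (fun x =>
      alexandrovLaplacian φ x + alexandrovLaplacian (legendre φ) (gradient φ x) - 2 * (n : ℝ)
        + ⟪gradient V (gradient φ x) - gradient V x, gradient φ x - x⟫)
    + ((1 / 2 : ℝ) : EReal) * extIntegral (μ.prod μ) (fun p =>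
        ⟪gradient W (gradient φ p.1 - gradient φ p.2) - gradient W (p.1 - p.2),
          gradient φ p.1 - gradient φ p.2 - (p.1 - p.2)⟫)

/-- The constant `C = 2 (6 / K + 4 R² |B(0, 2R)| e^M)⁻¹`, where `|B(0, 2R)|` is the Lebesgue
measure of the closed ball of radius `2R` in `ℝⁿ` (empty if `R < 0`). -/
def granConstant (n : ℕ) (K R M : ℝ) : ℝ :=
  2 * (6 / K + 4 * R ^ 2 *
    (volume (Metric.closedBall (0 : EuclideanSpace ℝ (Fin n)) (2 * R))).toReal * Real.exp M)⁻¹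

end

/-! Put `T = ∇φ` and `D = T - id`. The coupling `(T, id)` gives `W₂² ≤ ∫ |D|² dμ`, and since the
centers of mass agree, `2 ∫ |D|² dμ = ∬ |D x - D y|² dμ dμ`. It remains to bound `|D x - D y|²` for
each pair.

If `|x - y|` or `|T x - T y|` is at least `2R`, the interaction pays: at least a third of the
segment from `T x - T y` to `x - y` lies where `∇²W ≥ K`, so `(K/3) |D x - D y|²` is at most the
interaction integrand (`inner_gradient_sub_ge_of_uniformly_convex_outside_ball`).

If both are below `2R`, the Laplacian term pays. For `A = ∇²φ` positive definite, `tr A + tr A⁻¹ -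
2n = ∑ (λᵢ - 1)² / λᵢ`, whence `|A v - v|² ≤ gap(A) ⟨A v, v⟩`. Integration along `[y, x]` and
Cauchy–Schwarz give `|D x - D y|² ≤ ⟨T x - T y, x - y⟩ ∫ gap ≤ 4R² ∫ gap`
(`enorm_displacement_sub_sq_le`). The bound on `U` then turns the average over close pairs into `e^M
|B(0, 2R)| ∫ gap dμ` (`lintegral_segment_le`).

The gap is the Laplacian integrand of `J` because `∇²φ` is invertible `μ`-a.e. (Sard, as `ν` is
absolutely continuous) and `φ*` then has Hessian `(∇²φ)⁻¹` at `∇φ(x)`. -/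

/-! ### Gradients of `C²` convex functions along segments. -/

section Gradient

variable {E : Type*} [NormedAddCommGroup E] [InnerProductSpace ℝ E]

theorem ConvexOn.fderiv_fderiv_nonneg {f : E → ℝ} (hf : ContDiff ℝ 2 f)
    (hc : ConvexOn ℝ Set.univ f) (x v : E) : 0 ≤ fderiv ℝ (fderiv ℝ f) x v v := by
  have h : ContDiff ℝ 1 (fderiv ℝ f) := hf.fderiv_right (by norm_num)
  have hl : ∀ t : ℝ, HasDerivAt (fun t : ℝ => x + t • v) v t := fun t => by
    simpa using ((hasDerivAt_id t).smul_const v).const_add x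
  have hd : ∀ t : ℝ, HasDerivAt (fun t : ℝ => f (x + t • v)) (fderiv ℝ f (x + t • v) v) t :=
    fun t => (hf.differentiable (by norm_num) _).hasFDerivAt.comp_hasDerivAt t (hl t)
  have hg : ConvexOn ℝ Set.univ (fun t : ℝ => f (x + t • v)) := by
    have := hc.comp_affineMap (AffineMap.lineMap x (x + v))
    simp only [Set.preimage_univ] at this
    refine this.congr fun t _ => ?_
    simp [AffineMap.lineMap_apply, add_comm]
  have hmono : Monotone (fun t : ℝ => fderiv ℝ f (x + t • v) v) := by
    have h1 := hg.monotoneOn_deriv (fun t _ => (hd t).differentiableAt)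
    intro s t hst
    have := h1 (Set.mem_univ s) (Set.mem_univ t) hst
    rwa [(hd s).deriv, (hd t).deriv] at this
  have hd2 : HasDerivAt (fun t : ℝ => fderiv ℝ f (x + t • v) v)
      (fderiv ℝ (fderiv ℝ f) x v v) 0 := by
    have h1 := (h.differentiable (by norm_num) (x + (0:ℝ) • v)).hasFDerivAt.comp_hasDerivAt 0 (hl 0)
    have h2 := h1.clm_apply (hasDerivAt_const (0:ℝ) v)
    simpa using h2
  rw [← hd2.deriv]
  exact hmono.deriv_nonneg

/-- A segment with an endpoint outside `B(0, 2R)` spends at least a third of its length outside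
`B(0, R)`. -/
theorem one_third_le_volume_segment_outside_ball {R : ℝ} {a b : E} (hb : 2 * R ≤ ‖b‖)
    (hab : a ≠ b) :
    1 / 3 ≤ volume.real {t : ℝ | t ∈ Set.Icc (0:ℝ) 1 ∧ R ≤ ‖b + t • (a - b)‖} := by
  set S := {t : ℝ | t ∈ Set.Icc (0:ℝ) 1 ∧ R ≤ ‖b + t • (a - b)‖}
  set I := {t : ℝ | t ∈ Set.Icc (0:ℝ) 1 ∧ ‖b + t • (a - b)‖ < R}
  have hL : 0 < ‖a - b‖ := norm_pos_iff.2 (sub_ne_zero.2 hab)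
  have hSI : Set.Icc (0:ℝ) 1 = S ∪ I := by
    ext t
    simp only [S, I, Set.mem_union, Set.mem_ofPred_eq]
    constructor
    · intro h
      rcases le_or_gt R ‖b + t • (a - b)‖ with h' | h'
      · exact Or.inl ⟨h, h'⟩
      · exact Or.inr ⟨h, h'⟩
    · rintro (h | h) <;> exact h.1
  have hfin : ∀ s ⊆ Set.Icc (0:ℝ) 1, volume s ≠ ⊤ := fun s hs =>
    ne_top_of_le_ne_top (by simp) (measure_mono hs)
  have hI : volume.real I ≤ 2 / 3 := by
    -- A long segment meets the ball of radius `R` in a chord of length at most `2R`, hence in at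
    -- most two thirds of its parameters. On a short one, going from norm at least `2R` to below `R`
    -- takes length over `R`, hence time over `1 / 3`.
    rcases le_or_gt (3 * R) ‖a - b‖ with h3 | h3
    · rcases I.eq_empty_or_nonempty with he | ⟨t₀, ht₀⟩
      · rw [he]; simp; norm_num
      have hR : 0 ≤ R := (norm_nonneg _).trans ht₀.2.le
      have hdiam : Metric.ediam I ≤ ENNReal.ofReal (2 / 3) := by
        refine Metric.ediam_le fun s hs t ht => ?_
        rw [edist_dist]
        refine ENNReal.ofReal_le_ofReal ?_
        have h1 : ‖(s - t) • (a - b)‖ ≤ 2 * R := by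
          have : (s - t) • (a - b) = (b + s • (a - b)) - (b + t • (a - b)) := by
            rw [sub_smul]; abel
          rw [this]
          have := norm_sub_le (b + s • (a - b)) (b + t • (a - b))
          have h5 := hs.2
          have h6 := ht.2
          linarith
        rw [norm_smul] at h1
        rw [Real.dist_eq, ← Real.norm_eq_abs]
        nlinarith [norm_nonneg (s - t)]
      exact ENNReal.toReal_le_of_le_ofReal (by norm_num) ((Real.volume_le_diam I).trans hdiam)
    · have hsub : I ⊆ Set.Icc (1 / 3) 1 := by
        rintro t ⟨ht, h⟩
        refine ⟨?_, ht.2⟩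
        have h1 : ‖b‖ ≤ ‖b + t • (a - b)‖ + ‖t • (a - b)‖ := by
          simpa using norm_sub_le (b + t • (a - b)) (t • (a - b))
        rw [norm_smul, Real.norm_of_nonneg ht.1] at h1
        nlinarith
      refine (measureReal_mono hsub (hfin _ (Set.Icc_subset_Icc_left (by norm_num)))).trans ?_
      rw [Real.volume_real_Icc]
      norm_num
  have h1 : (1:ℝ) ≤ volume.real S + volume.real I := by
    refine le_trans ?_ (measureReal_union_le S I)
    rw [← hSI, Real.volume_real_Icc]
    norm_num
  linarith

variable [CompleteSpace E]

theorem ContDiff.gradient_one {f : E → ℝ} (hf : ContDiff ℝ 2 f) : ContDiff ℝ 1 (gradient f) := by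
  have h : ContDiff ℝ 1 (fderiv ℝ f) := hf.fderiv_right (by norm_num)
  exact (InnerProductSpace.toDual ℝ E).symm.toContinuousLinearEquiv.contDiff.comp h

theorem inner_fderiv_gradient {f : E → ℝ} (hf : ContDiff ℝ 2 f) (x v w : E) :
    ⟪fderiv ℝ (gradient f) x v, w⟫ = fderiv ℝ (fderiv ℝ f) x v w := by
  have h : ContDiff ℝ 1 (fderiv ℝ f) := hf.fderiv_right (by norm_num)
  have h1 : HasFDerivAt (fderiv ℝ f) (fderiv ℝ (fderiv ℝ f) x) x :=
    (h.differentiable (by norm_num) x).hasFDerivAt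
  have h2 := (InnerProductSpace.toDual ℝ E).symm.toContinuousLinearEquiv.hasFDerivAt.comp x h1
  have h3 : fderiv ℝ (gradient f) x = _ := h2.fderiv
  rw [h3]
  exact InnerProductSpace.toDual_symm_apply

theorem isSymmetric_fderiv_gradient {f : E → ℝ} (hf : ContDiff ℝ 2 f) (x : E) :
    (fderiv ℝ (gradient f) x : E →ₗ[ℝ] E).IsSymmetric := by
  intro v w
  have h : IsSymmSndFDerivAt ℝ f x := hf.contDiffAt.isSymmSndFDerivAt (by simp)
  simp only [ContinuousLinearMap.coe_coe]
  rw [inner_fderiv_gradient hf, real_inner_comm, inner_fderiv_gradient hf]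
  exact h.eq v w

theorem gradient_sub_eq_integral {f : E → ℝ} (hf : ContDiff ℝ 2 f) (x y : E) :
    gradient f x - gradient f y =
      ∫ t in (0:ℝ)..1, fderiv ℝ (gradient f) (y + t • (x - y)) (x - y) := by
  have h := hf.gradient_one
  have hl : ∀ t : ℝ, HasDerivAt (fun t : ℝ => y + t • (x - y)) (x - y) t := fun t => by
    simpa using ((hasDerivAt_id t).smul_const (x - y)).const_add y
  have hd : ∀ t : ℝ, HasDerivAt (fun t : ℝ => gradient f (y + t • (x - y)))
      (fderiv ℝ (gradient f) (y + t • (x - y)) (x - y)) t :=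
    fun t => (h.differentiable (by norm_num) _).hasFDerivAt.comp_hasDerivAt t (hl t)
  have hcont : Continuous fun t : ℝ => fderiv ℝ (gradient f) (y + t • (x - y)) (x - y) := by
    have := h.continuous_fderiv (by norm_num)
    fun_prop
  rw [intervalIntegral.integral_eq_sub_of_hasDerivAt (fun t _ => hd t)
    (hcont.intervalIntegrable _ _)]
  simp

theorem inner_gradient_sub_eq_integral {f : E → ℝ} (hf : ContDiff ℝ 2 f) (x y w : E) :
    ⟪gradient f x - gradient f y, w⟫ =
      ∫ t in (0:ℝ)..1, fderiv ℝ (fderiv ℝ f) (y + t • (x - y)) (x - y) w := by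
  have hcont : Continuous fun t : ℝ => fderiv ℝ (gradient f) (y + t • (x - y)) (x - y) := by
    have := hf.gradient_one.continuous_fderiv (by norm_num)
    fun_prop
  rw [gradient_sub_eq_integral hf, real_inner_comm]
  have := (innerSL ℝ w).intervalIntegral_comp_comm (hcont.intervalIntegrable 0 1 (μ := volume))
  simp only [innerSL_apply_apply] at this
  rw [← this]
  refine intervalIntegral.integral_congr fun t _ => ?_
  rw [← inner_fderiv_gradient hf, real_inner_comm]

theorem ConvexOn.inner_gradient_sub_nonneg {f : E → ℝ} (hf : ContDiff ℝ 2 f)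
    (hc : ConvexOn ℝ Set.univ f) (x y : E) :
    0 ≤ ⟪gradient f x - gradient f y, x - y⟫ := by
  rw [inner_gradient_sub_eq_integral hf]
  exact intervalIntegral.integral_nonneg (by norm_num) fun t _ => hc.fderiv_fderiv_nonneg hf _ _

/-- The second derivative along the segment is at least `K |a - b|²` on a third of it and
nonnegative on the rest by convexity. -/
theorem inner_gradient_sub_ge_of_uniformly_convex_outside_ball {W : E → ℝ} {K R : ℝ} (hK : 0 ≤ K)
    (hW : ContDiff ℝ 2 W) (hc : ConvexOn ℝ Set.univ W)
    (h : ∀ x, R ≤ ‖x‖ → ∀ v, K * ‖v‖ ^ 2 ≤ fderiv ℝ (fderiv ℝ W) x v v) {a b : E}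
    (hab : 2 * R ≤ ‖a‖ ∨ 2 * R ≤ ‖b‖) :
    K / 3 * ‖a - b‖ ^ 2 ≤ ⟪gradient W a - gradient W b, a - b⟫ := by
  wlog hb : 2 * R ≤ ‖b‖ generalizing a b
  · have := this hab.symm (hab.resolve_right hb)
    rwa [norm_sub_rev, ← neg_sub (gradient W a), ← neg_sub a b, inner_neg_neg] at this
  rcases eq_or_ne a b with rfl | hne
  · simp
  set S := {t : ℝ | t ∈ Set.Icc (0:ℝ) 1 ∧ R ≤ ‖b + t • (a - b)‖} with hS
  have hS3 : 1 / 3 ≤ volume.real S := one_third_le_volume_segment_outside_ball hb hne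
  have hSm : MeasurableSet S := by
    have : Continuous fun t : ℝ => ‖b + t • (a - b)‖ := by fun_prop
    exact measurableSet_Icc.inter (measurableSet_le measurable_const this.measurable)
  have hcont : Continuous fun t : ℝ =>
      fderiv ℝ (fderiv ℝ W) (b + t • (a - b)) (a - b) (a - b) := by
    have h1 : ContDiff ℝ 1 (fderiv ℝ W) := hW.fderiv_right (by norm_num)
    have := h1.continuous_fderiv (by norm_num)
    fun_prop
  have hint : IntegrableOn (fun t : ℝ =>
      fderiv ℝ (fderiv ℝ W) (b + t • (a - b)) (a - b) (a - b)) (Set.Icc 0 1) :=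
    hcont.continuousOn.integrableOn_compact isCompact_Icc
  have hsub : S ⊆ Set.Icc 0 1 := fun t ht => ht.1
  rw [inner_gradient_sub_eq_integral hW, intervalIntegral.integral_of_le zero_le_one,
    ← integral_Icc_eq_integral_Ioc]
  calc K / 3 * ‖a - b‖ ^ 2 ≤ K * ‖a - b‖ ^ 2 * volume.real S := by
        have : 0 ≤ K * ‖a - b‖ ^ 2 := by positivity
        nlinarith
    _ ≤ ∫ t in S, fderiv ℝ (fderiv ℝ W) (b + t • (a - b)) (a - b) (a - b) := by
        refine setIntegral_ge_of_const_le_real hSm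
          (ne_top_of_le_ne_top (by simp) (measure_mono hsub)) (fun t ht => h _ ht.2 _)
          (hint.mono_set hsub)
    _ ≤ _ := setIntegral_mono_set hint
        (Eventually.of_forall fun t => hc.fderiv_fderiv_nonneg hW _ _) hsub.eventuallyLE

end Gradient

/-! ### The gap `tr A + tr A⁻¹ - 2n` and the displacement it controls. -/

section HessianGap

variable {E : Type*} [NormedAddCommGroup E] [InnerProductSpace ℝ E]

/-- `tr A + tr A⁻¹ - 2 dim E`. -/
noncomputable def hessianGap (A : E →L[ℝ] E) : ℝ :=
  LinearMap.trace ℝ E A + LinearMap.trace ℝ E (Ring.inverse A : E →L[ℝ] E) - 2 * Module.finrank ℝ E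

/-- `hessianGap`, with the value `∞` at the operators that are not invertible. -/
noncomputable def ehessianGap (A : E →L[ℝ] E) : ℝ≥0∞ :=
  open Classical in if IsUnit A then ENNReal.ofReal (hessianGap A) else ⊤

/-- In an eigenbasis, `(λᵢ - 1)² vᵢ² = ((λᵢ - 1)² / λᵢ) · λᵢ vᵢ²`, and each first factor is one of
the nonnegative terms whose sum is the gap. -/
theorem norm_sub_sq_le_hessianGap_mul_inner [FiniteDimensional ℝ E] {A : E →L[ℝ] E}
    (hs : (A : E →ₗ[ℝ] E).IsSymmetric) (hp : ∀ v, 0 ≤ ⟪A v, v⟫) (hu : IsUnit A) (v : E) :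
    0 ≤ hessianGap A ∧ ‖A v - v‖ ^ 2 ≤ hessianGap A * ⟪A v, v⟫ := by
  obtain ⟨u, rfl⟩ := hu
  set A : E →L[ℝ] E := (u : E →L[ℝ] E) with hA
  set b := hs.eigenvectorBasis rfl
  set l := hs.eigenvalues rfl
  have hb : ∀ i, A (b i) = l i • b i := fun i => hs.apply_eigenvectorBasis rfl i
  have hbne : ∀ i, b i ≠ 0 := fun i => b.orthonormal.ne_zero i
  have huu : ∀ w, (↑u⁻¹ : E →L[ℝ] E) (A w) = w := fun w => by
    rw [hA, ← mul_apply_eq_comp, Units.inv_mul, one_apply_eq_self]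
  have hl : ∀ i, 0 < l i := fun i => by
    have h1 : 0 ≤ l i := by
      have := hp (b i)
      rw [hb, real_inner_smul_left, real_inner_self_eq_norm_sq, b.orthonormal.1] at this
      simpa using this
    refine h1.lt_of_ne fun h0 => hbne i ?_
    have := huu (b i)
    rw [hb, ← h0] at this
    simpa using this.symm
  have hinv : ∀ i, (↑u⁻¹ : E →L[ℝ] E) (b i) = (l i)⁻¹ • b i := fun i => by
    have := huu (b i)
    rw [hb, map_smul] at this
    rw [← this, smul_smul, inv_mul_cancel₀ (hl i).ne', one_smul, this]
  have hgap : hessianGap A = ∑ i, (l i - 1) ^ 2 / l i := by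
    have h2 : (2 * Module.finrank ℝ E : ℝ) = ∑ _i : Fin (Module.finrank ℝ E), (2:ℝ) := by
      simp [mul_comm]
    rw [hessianGap, hA, Ring.inverse_unit, LinearMap.trace_eq_sum_inner _ b,
      LinearMap.trace_eq_sum_inner _ b, h2, ← Finset.sum_add_distrib, ← Finset.sum_sub_distrib]
    refine Finset.sum_congr rfl fun i _ => ?_
    simp only [ContinuousLinearMap.coe_coe]
    rw [hinv, ← hA, hb, real_inner_smul_right, real_inner_smul_right, real_inner_self_eq_norm_sq,
      b.orthonormal.1]
    have := (hl i).ne'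
    field_simp
    ring
  have hc : ∀ i, ⟪b i, A v⟫ = l i * ⟪b i, v⟫ := fun i => by
    have := hs (b i) v
    simp only [ContinuousLinearMap.coe_coe] at this
    rw [← this, hb, real_inner_smul_left]
  have hnorm : ‖A v - v‖ ^ 2 = ∑ i, (l i - 1) ^ 2 * ⟪b i, v⟫ ^ 2 := by
    rw [← b.sum_sq_inner_right]
    refine Finset.sum_congr rfl fun i _ => ?_
    rw [inner_sub_right, hc]
    ring
  have hquad : ⟪A v, v⟫ = ∑ i, l i * ⟪b i, v⟫ ^ 2 := by
    rw [← b.sum_inner_mul_inner]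
    refine Finset.sum_congr rfl fun i _ => ?_
    rw [real_inner_comm, hc]
    ring
  have h0 : ∀ i, 0 ≤ (l i - 1) ^ 2 / l i := fun i => div_nonneg (sq_nonneg _) (hl i).le
  refine ⟨hgap ▸ Finset.sum_nonneg fun i _ => h0 i, ?_⟩
  rw [hgap, hnorm, hquad, Finset.mul_sum]
  refine Finset.sum_le_sum fun i _ => ?_
  have h1 : (l i - 1) ^ 2 / l i ≤ ∑ j, (l j - 1) ^ 2 / l j :=
    Finset.single_le_sum (fun j _ => h0 j) (Finset.mem_univ i)
  calc (l i - 1) ^ 2 * ⟪b i, v⟫ ^ 2 = (l i - 1) ^ 2 / l i * (l i * ⟪b i, v⟫ ^ 2) := by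
        have := (hl i).ne'
        field_simp
    _ ≤ _ := mul_le_mul_of_nonneg_right h1 (mul_nonneg (hl i).le (sq_nonneg _))

theorem enorm_sub_le_ehessianGap [FiniteDimensional ℝ E] {A : E →L[ℝ] E}
    (hs : (A : E →ₗ[ℝ] E).IsSymmetric) (hp : ∀ v, 0 ≤ ⟪A v, v⟫) (hu : IsUnit A) (v : E) :
    ‖A v - v‖ₑ ≤ ehessianGap A ^ (1 / 2 : ℝ) * ENNReal.ofReal ⟪A v, v⟫ ^ (1 / 2 : ℝ) := by
  obtain ⟨h0, h1⟩ := norm_sub_sq_le_hessianGap_mul_inner hs hp hu v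
  rw [ehessianGap, if_pos hu, ← ENNReal.mul_rpow_of_nonneg _ _ (by norm_num),
    ← ENNReal.ofReal_mul h0, ← ofReal_norm,
    ENNReal.ofReal_rpow_of_nonneg (mul_nonneg h0 (hp v)) (by norm_num), ← Real.sqrt_eq_rpow]
  exact ENNReal.ofReal_le_ofReal (Real.le_sqrt_of_sq_le h1)

theorem isOpen_isUnit_clm [CompleteSpace E] : IsOpen {A : E →L[ℝ] E | IsUnit A} :=
  Units.isOpen

/-- The gap is continuous on the open set of invertible operators and constant off it. -/
theorem measurable_ehessianGap [FiniteDimensional ℝ E] :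
    Measurable (ehessianGap : (E →L[ℝ] E) → ℝ≥0∞) := by
  classical
  have hE : CompleteSpace E := FiniteDimensional.complete ℝ E
  have htr : Continuous fun A : E →L[ℝ] E => LinearMap.trace ℝ E (A : E →ₗ[ℝ] E) :=
    ((LinearMap.trace ℝ E).comp (ContinuousLinearMap.coeLM ℝ)).continuous_of_finiteDimensional
  have hcont : ContinuousOn (fun A : E →L[ℝ] E => ENNReal.ofReal (hessianGap A)) {A | IsUnit A} := by
    rintro _ ⟨u, rfl⟩
    refine ContinuousAt.continuousWithinAt ?_
    refine ENNReal.continuous_ofReal.continuousAt.comp ?_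
    have h1 := htr.continuousAt.comp (NormedRing.inverse_continuousAt u)
    exact (htr.continuousAt.add h1).sub continuousAt_const
  have h := hcont.measurable_piecewise (continuousOn_const (c := (⊤ : ℝ≥0∞)))
    (isOpen_isUnit_clm (E := E)).measurableSet
  convert h using 1
  ext A
  simp [ehessianGap, Set.piecewise]

/-- `D = ∇φ - id` along a segment is controlled by the Hessian gap. -/
theorem enorm_displacement_sub_sq_le [FiniteDimensional ℝ E] [CompleteSpace E] {f : E → ℝ}
    (hf : ContDiff ℝ 2 f) (hc : ConvexOn ℝ Set.univ f) {x y : E} {c : ℝ} (hc0 : 0 < c)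
    (hxy : ⟪gradient f x - gradient f y, x - y⟫ ≤ c) :
    ‖(gradient f x - x) - (gradient f y - y)‖ₑ ^ 2 ≤
      ENNReal.ofReal c *
        ∫⁻ t in Set.Ioc (0:ℝ) 1, ehessianGap (fderiv ℝ (gradient f) (y + t • (x - y))) := by
  set G := fun t : ℝ => ehessianGap (fderiv ℝ (gradient f) (y + t • (x - y))) with hG
  set v := x - y with hv
  set Q := fun t : ℝ => ENNReal.ofReal ⟪fderiv ℝ (gradient f) (y + t • v) v, v⟫ with hQ
  have hcA : Continuous fun t : ℝ => fderiv ℝ (gradient f) (y + t • v) := by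
    have := hf.gradient_one.continuous_fderiv (by norm_num)
    fun_prop
  have hcv : Continuous fun t : ℝ => fderiv ℝ (gradient f) (y + t • v) v := by fun_prop
  have hGm : Measurable G := measurable_ehessianGap.comp hcA.measurable
  have hcq : Continuous fun t : ℝ => ⟪fderiv ℝ (gradient f) (y + t • v) v, v⟫ := by fun_prop
  have hQm : Measurable Q := hcq.measurable.ennreal_ofReal
  have hpsd : ∀ z w, 0 ≤ ⟪fderiv ℝ (gradient f) z w, w⟫ := fun z w => by
    rw [inner_fderiv_gradient hf]
    exact hc.fderiv_fderiv_nonneg hf z w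
  have hQint : ∫⁻ t in Set.Ioc (0:ℝ) 1, Q t =
      ENNReal.ofReal ⟪gradient f x - gradient f y, v⟫ := by
    rw [inner_gradient_sub_eq_integral hf, intervalIntegral.integral_of_le zero_le_one,
      ofReal_integral_eq_lintegral_ofReal]
    · simp only [hQ, inner_fderiv_gradient hf, hv]
    · simp only [← inner_fderiv_gradient hf]
      exact (hcq.integrableOn_Icc (a := 0) (b := 1)).mono_set Set.Ioc_subset_Icc_self
    · exact Eventually.of_forall fun t => hc.fderiv_fderiv_nonneg hf _ _
  have hdisp : (gradient f x - x) - (gradient f y - y) =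
      ∫ t in Set.Ioc (0:ℝ) 1, (fderiv ℝ (gradient f) (y + t • v) v - v) := by
    rw [← intervalIntegral.integral_of_le zero_le_one,
      intervalIntegral.integral_sub (hcv.intervalIntegrable _ _) (by simp),
      ← gradient_sub_eq_integral hf]
    simp [hv]
    abel
  -- Invertibility `μ`-a.e. says nothing about a given segment. The value `⊤` at singular operators
  -- settles this: either the bound is trivial, or the Hessian is invertible at almost every `t`.
  by_cases htop : ∫⁻ t in Set.Ioc (0:ℝ) 1, G t = ⊤
  · rw [htop, ENNReal.mul_top (by simpa using hc0)]
    exact le_top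
  have hfin : ∀ᵐ t ∂volume.restrict (Set.Ioc (0:ℝ) 1), G t < ⊤ := ae_lt_top hGm htop
  have hle : ‖(gradient f x - x) - (gradient f y - y)‖ₑ ≤
      ∫⁻ t in Set.Ioc (0:ℝ) 1, ((fun t => G t ^ (1 / 2 : ℝ)) * fun t => Q t ^ (1 / 2 : ℝ)) t := by
    rw [hdisp]
    refine (enorm_integral_le_lintegral_enorm _).trans (lintegral_mono_ae ?_)
    filter_upwards [hfin] with t ht
    refine enorm_sub_le_ehessianGap (isSymmetric_fderiv_gradient hf _) (hpsd _) ?_ v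
    by_contra hnu
    simp [hG, ehessianGap, hnu] at ht
  have hCS := hle.trans (ENNReal.lintegral_mul_le_Lp_mul_Lq _ Real.HolderConjugate.two_two
    (hGm.pow_const _).aemeasurable (hQm.pow_const _).aemeasurable)
  simp only [← ENNReal.rpow_mul] at hCS
  norm_num at hCS
  calc _ ≤ _ := pow_le_pow_left' hCS 2
    _ = ENNReal.ofReal ⟪gradient f x - gradient f y, v⟫ * ∫⁻ t in Set.Ioc (0:ℝ) 1, G t := by
      rw [← hQint, mul_pow, ← ENNReal.rpow_two, ← ENNReal.rpow_two, ← ENNReal.rpow_mul, ← ENNReal.rpow_mul]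
      norm_num
      rw [mul_comm]
    _ ≤ _ := by gcongr
end HessianGap

/-! ### Alexandrov Hessians of `φ` and of its Legendre transform. -/

section Alexandrov

/-- By symmetry of `A` the remainder has gradient `g (x + h) - g x - A h = o(|h|)`; the mean value
inequality on the ball of radius `|h|` gains the other factor. Differentiability of `g` at the
single point `x` suffices. -/
theorem isLittleO_second_order_of_hasGradientAt {E : Type*} [NormedAddCommGroup E]
    [InnerProductSpace ℝ E] [CompleteSpace E] {f : E → ℝ} {g : E → E} {A : E →L[ℝ] E} {x : E}
    (hs : (A : E →ₗ[ℝ] E).IsSymmetric) (hf : ∀ᶠ y in 𝓝 x, HasGradientAt f (g y) y)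
    (hg : HasFDerivAt g A x) :
    (fun h => f (x + h) - f x - ⟪g x, h⟫ - ⟪A h, h⟫ / 2) =o[𝓝 0] fun h => ‖h‖ ^ 2 := by
  set r : E → ℝ := fun h => f (x + h) - f x - ⟪g x, h⟫ - ⟪A h, h⟫ / 2 with hr
  have hadd : Tendsto (fun h : E => x + h) (𝓝 0) (𝓝 x) := by
    have : Continuous fun h : E => x + h := by fun_prop
    simpa using this.tendsto 0
  have hd : ∀ᶠ h in 𝓝 (0:E), HasFDerivAt r (innerSL ℝ (g (x + h) - g x - A h)) h := by
    filter_upwards [hadd.eventually hf] with h hh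
    have h1 : HasFDerivAt (fun h => f (x + h)) (innerSL ℝ (g (x + h))) h := by
      have h2 : HasFDerivAt f (innerSL ℝ (g (x + h))) (x + h) := hh.hasFDerivAt
      have h3 := h2.comp h ((hasFDerivAt_id h).const_add x)
      rwa [ContinuousLinearMap.comp_id] at h3
    have h3 : HasFDerivAt (fun h => ⟪g x, h⟫) (innerSL ℝ (g x)) h := (innerSL ℝ (g x)).hasFDerivAt
    have h4 := (A.hasFDerivAt (x := h)).inner ℝ (hasFDerivAt_id h)
    have h5 := ((h1.sub_const (f x)).sub h3).sub (h4.mul_const (1 / 2))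
    refine (h5.congr_fderiv ?_).congr_of_eventuallyEq (Eventually.of_forall fun z => ?_)
    · ext w
      have := hs h w
      simp only [ContinuousLinearMap.coe_coe] at this
      simp [this, real_inner_comm h (A w)]
      ring
    · simp [hr]; ring
  rw [isLittleO_iff]
  intro ε hε
  have hlo := (hasFDerivAt_iff_isLittleO_nhds_zero.1 hg).def hε
  obtain ⟨δ, hδ, hball⟩ := Metric.eventually_nhds_iff_ball.1 (hd.and hlo)
  filter_upwards [Metric.ball_mem_nhds (0:E) hδ] with h hh
  have hsub : ∀ z ∈ Metric.closedBall (0:E) ‖h‖, z ∈ Metric.ball (0:E) δ := fun z hz => by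
    simp only [Metric.mem_closedBall, dist_zero_right, Metric.mem_ball] at hz hh ⊢
    exact hz.trans_lt hh
  have := (convex_closedBall (0:E) ‖h‖).norm_image_sub_le_of_norm_hasFDerivWithin_le
    (f := r) (C := ε * ‖h‖) (x := 0) (y := h)
    (fun z hz => (hball z (hsub z hz)).1.hasFDerivWithinAt) (fun z hz => by
      rw [innerSL_apply_norm]
      refine (hball z (hsub z hz)).2.trans ?_
      simp only [Metric.mem_closedBall, dist_zero_right] at hz
      gcongr) (by simp) (by simp)
  have hr0 : r 0 = 0 := by simp [hr]
  rw [hr0, sub_zero, sub_zero] at this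
  rw [norm_pow, norm_norm]
  calc ‖r h‖ ≤ _ := this
    _ = _ := by ring

variable {n : ℕ} {φ : EuclideanSpace ℝ (Fin n) → ℝ}

theorem ContDiff.hasGradientAt_gradient {E : Type*} [NormedAddCommGroup E]
    [InnerProductSpace ℝ E] [CompleteSpace E] {f : E → ℝ} (hf : ContDiff ℝ 2 f) (x : E) :
    HasGradientAt f (gradient f x) x :=
  (hf.differentiable (by norm_num) x).hasGradientAt

theorem hasAlexandrovHessianAt_fderiv_gradient (hφ : ContDiff ℝ 2 φ)
    (x : EuclideanSpace ℝ (Fin n)) :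
    HasAlexandrovHessianAt φ (fderiv ℝ (gradient φ) x) x := by
  refine ⟨isSymmetric_fderiv_gradient hφ x, gradient φ x, ?_⟩
  exact isLittleO_second_order_of_hasGradientAt (isSymmetric_fderiv_gradient hφ x)
    (Eventually.of_forall hφ.hasGradientAt_gradient)
    (hφ.gradient_one.differentiable (by norm_num) x).hasFDerivAt

theorem ConvexOn.add_inner_gradient_le {E : Type*} [NormedAddCommGroup E]
    [InnerProductSpace ℝ E] [CompleteSpace E] {f : E → ℝ} (hc : ConvexOn ℝ Set.univ f)
    (hf : ContDiff ℝ 2 f) (x z : E) : f x + ⟪gradient f x, z - x⟫ ≤ f z := by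
  have hl : HasDerivAt (fun t : ℝ => x + t • (z - x)) (z - x) 0 := by
    simpa using ((hasDerivAt_id (0:ℝ)).smul_const (z - x)).const_add x
  have hd : HasDerivAt (fun t : ℝ => f (x + t • (z - x))) ⟪gradient f x, z - x⟫ 0 := by
    have h1 : HasFDerivAt f (innerSL ℝ (gradient f x)) (x + (0:ℝ) • (z - x)) := by
      rw [zero_smul, add_zero]
      exact (hf.hasGradientAt_gradient x).hasFDerivAt
    exact h1.comp_hasDerivAt 0 hl
  have hg : ConvexOn ℝ Set.univ (fun t : ℝ => f (x + t • (z - x))) := by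
    have := hc.comp_affineMap (AffineMap.lineMap x z)
    simp only [Set.preimage_univ] at this
    refine this.congr fun t _ => ?_
    simp [AffineMap.lineMap_apply, add_comm]
  have := hg.le_slope_of_hasDerivAt (Set.mem_univ 0) (Set.mem_univ 1) zero_lt_one hd
  simp only [slope_def_field, one_smul, zero_smul, add_zero, add_sub_cancel, sub_zero,
    div_one] at this
  linarith

theorem inner_sub_le_of_convexOn (hc : ConvexOn ℝ Set.univ φ) (hφ : ContDiff ℝ 2 φ)
    (z w : EuclideanSpace ℝ (Fin n)) :
    ⟪w, gradient φ z⟫ - φ w ≤ ⟪z, gradient φ z⟫ - φ z := by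
  have := hc.add_inner_gradient_le hφ z w
  rw [inner_sub_right, real_inner_comm, real_inner_comm z] at this
  linarith

theorem legendre_gradient (hc : ConvexOn ℝ Set.univ φ) (hφ : ContDiff ℝ 2 φ)
    (z : EuclideanSpace ℝ (Fin n)) :
    legendre φ (gradient φ z) = ⟪z, gradient φ z⟫ - φ z :=
  le_antisymm (ciSup_le fun w => inner_sub_le_of_convexOn hc hφ z w)
    (le_ciSup (f := fun w => ⟪w, gradient φ z⟫ - φ w)
      ⟨_, Set.forall_mem_range.2 fun w => inner_sub_le_of_convexOn hc hφ z w⟩ z)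

/-- The local inverse `S` of `∇φ` is the gradient of `φ*` near `∇φ(x)`, and the derivative of `S` at
`∇φ(x)` is the inverse Hessian. -/
theorem hasAlexandrovHessianAt_legendre (hc : ConvexOn ℝ Set.univ φ) (hφ : ContDiff ℝ 2 φ)
    {x : EuclideanSpace ℝ (Fin n)} (hu : IsUnit (fderiv ℝ (gradient φ) x)) :
    HasAlexandrovHessianAt (legendre φ)
      (Ring.inverse (fderiv ℝ (gradient φ) x) :
        EuclideanSpace ℝ (Fin n) →L[ℝ] EuclideanSpace ℝ (Fin n)) (gradient φ x) := by
  obtain ⟨u, hu⟩ := hu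
  set e := ContinuousLinearEquiv.unitsEquiv ℝ (EuclideanSpace ℝ (Fin n)) u with he
  have hinv : Ring.inverse (fderiv ℝ (gradient φ) x) = e.symm := by
    rw [← hu, Ring.inverse_unit]
    rfl
  have hue : fderiv ℝ (gradient φ) x = e := by rw [← hu]; rfl
  have hstrict : HasStrictFDerivAt (gradient φ)
      (e : EuclideanSpace ℝ (Fin n) →L[ℝ] EuclideanSpace ℝ (Fin n)) x := by
    rw [← hue]
    exact hφ.gradient_one.contDiffAt.hasStrictFDerivAt (by norm_num)
  set S := hstrict.localInverse (gradient φ) e x with hS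
  have hSx : S (gradient φ x) = x := hstrict.localInverse_apply_image
  have hSd : HasFDerivAt S (e.symm : EuclideanSpace ℝ (Fin n) →L[ℝ] EuclideanSpace ℝ (Fin n))
      (gradient φ x) := hstrict.to_localInverse.hasFDerivAt
  have hright : ∀ᶠ y in 𝓝 (gradient φ x), gradient φ (S y) = y := hstrict.eventually_right_inverse
  have hcontS : ∀ᶠ y in 𝓝 (gradient φ x), ContinuousAt S y := by
    have h1 := (hstrict.toOpenPartialHomeomorph (gradient φ)).open_target.mem_nhds
      (hstrict.image_mem_toOpenPartialHomeomorph_target)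
    filter_upwards [h1] with y hy
    exact (hstrict.toOpenPartialHomeomorph (gradient φ)).symm.continuousAt hy
  have hgrad : ∀ᶠ y in 𝓝 (gradient φ x), HasGradientAt (legendre φ) (S y) y := by
    filter_upwards [hright.eventually_nhds, hcontS] with y hy hcy
    rw [hasGradientAt_iff_isLittleO]
    have hy0 := hy.self_of_nhds
    have hz : (fun z => ‖S z - S y‖ * ‖z - y‖) =o[𝓝 y] fun z => z - y := by
      have h1 : (fun z => ‖S z - S y‖) =o[𝓝 y] fun _ => (1:ℝ) := by
        rw [isLittleO_one_iff]
        have := (hcy.tendsto.sub_const (S y)).norm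
        simpa using this
      have h2 : (fun z => ‖z - y‖) =O[𝓝 y] fun z => ‖z - y‖ := isBigO_refl _ _
      have h3 := h1.mul_isBigO h2
      simp only [one_mul] at h3
      exact h3.of_norm_right
    refine IsBigO.trans_isLittleO (IsBigO.of_bound 1 ?_) hz
    filter_upwards [hy] with z hz
    have e1 : legendre φ z = ⟪S z, z⟫ - φ (S z) := by
      have := legendre_gradient hc hφ (S z)
      rwa [hz] at this
    have e2 : legendre φ y = ⟪S y, y⟫ - φ (S y) := by
      have := legendre_gradient hc hφ (S y)
      rwa [hy0] at this
    -- The two Fenchel inequalities squeeze `φ*(z) - φ*(y) - ⟨S y, z - y⟩` between `0` and `⟨S z - S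
    -- y, z - y⟩`, which is `o(|z - y|)` by continuity of `S` at `y`.
    have i1 := inner_sub_le_of_convexOn hc hφ (S z) (S y)
    have i2 := inner_sub_le_of_convexOn hc hφ (S y) (S z)
    rw [hz] at i1
    rw [hy0] at i2
    have i3 := real_inner_le_norm (S z - S y) (z - y)
    rw [inner_sub_left, inner_sub_right, inner_sub_right] at i3
    rw [e1, e2, inner_sub_right, one_mul, Real.norm_eq_abs, abs_le, norm_mul, norm_norm, norm_norm]
    constructor
    · have := mul_nonneg (norm_nonneg (S z - S y)) (norm_nonneg (z - y))
      linarith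
    · linarith
  have hsymm : ((e.symm : EuclideanSpace ℝ (Fin n) →L[ℝ] EuclideanSpace ℝ (Fin n)) :
      EuclideanSpace ℝ (Fin n) →ₗ[ℝ] EuclideanSpace ℝ (Fin n)).IsSymmetric := by
    intro v w
    have h1 := isSymmetric_fderiv_gradient hφ x (e.symm v) (e.symm w)
    rw [hue] at h1
    simpa using h1.symm
  rw [hinv]
  refine ⟨hsymm, x, ?_⟩
  have := isLittleO_second_order_of_hasGradientAt hsymm hgrad hSd
  rw [hSx] at this
  exact this

theorem alexandrovLaplacian_add_legendre (hc : ConvexOn ℝ Set.univ φ) (hφ : ContDiff ℝ 2 φ)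
    {x : EuclideanSpace ℝ (Fin n)} (hu : IsUnit (fderiv ℝ (gradient φ) x)) :
    alexandrovLaplacian φ x + alexandrovLaplacian (legendre φ) (gradient φ x) - 2 * (n : ℝ) =
      hessianGap (fderiv ℝ (gradient φ) x) := by
  rw [(hasAlexandrovHessianAt_fderiv_gradient hφ x).laplacian_eq,
    (hasAlexandrovHessianAt_legendre hc hφ hu).laplacian_eq, hessianGap, finrank_euclideanSpace_fin]

end Alexandrov

/-! ### Transport cost and variance. -/

section Coupling

theorem W2_map_sq_le {n : ℕ} {μ : Measure (EuclideanSpace ℝ (Fin n))}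
    {T : EuclideanSpace ℝ (Fin n) → EuclideanSpace ℝ (Fin n)} (hT : Measurable T) :
    W2 (μ.map T) μ ^ 2 ≤ ∫⁻ x, ‖T x - x‖ₑ ^ 2 ∂μ := by
  have hm : Measurable fun x => (T x, x) := hT.prodMk measurable_id
  have h : W2 (μ.map T) μ ≤ (∫⁻ x, ‖T x - x‖ₑ ^ 2 ∂μ) ^ (1 / 2 : ℝ) := by
    refine (iInf₂_le (μ.map fun x => (T x, x)) ⟨?_, ?_⟩).trans_eq ?_
    · rw [lintegral_map (by fun_prop) hm]
    · rw [Measure.map_map measurable_fst hm]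
      rfl
    · rw [Measure.map_map measurable_snd hm]
      exact Measure.map_id
  calc _ ≤ _ := pow_le_pow_left' h 2
    _ = _ := by
      rw [← ENNReal.rpow_two, ← ENNReal.rpow_mul]
      norm_num

/-- Expanding the square, the cross term integrates to zero because `D` has mean zero. -/
theorem two_mul_lintegral_enorm_sq_eq_of_integral_eq_zero {α E : Type*} [MeasurableSpace α]
    [NormedAddCommGroup E] [InnerProductSpace ℝ E] [CompleteSpace E] [MeasurableSpace E]
    [BorelSpace E] [SecondCountableTopology E]
    {μ : Measure α} [IsProbabilityMeasure μ] {D : α → E} (hm : Measurable D)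
    (hD : MemLp D 2 μ) (h0 : ∫ x, D x ∂μ = 0) :
    2 * ∫⁻ x, ‖D x‖ₑ ^ 2 ∂μ = ∫⁻ p, ‖D p.1 - D p.2‖ₑ ^ 2 ∂μ.prod μ := by
  have hi : Integrable D μ := hD.integrable (by norm_num)
  have hsq : Integrable (fun x => ‖D x‖ ^ 2) μ := hD.integrable_norm_pow (by norm_num)
  have hconv : ∀ e : E, ‖e‖ₑ ^ 2 = ENNReal.ofReal (‖e‖ ^ 2) := fun e => by
    rw [ENNReal.ofReal_pow (norm_nonneg _), ofReal_norm]
  rw [lintegral_prod _ (by fun_prop)]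
  have hinner : ∀ x, ∫⁻ y, ‖D x - D y‖ₑ ^ 2 ∂μ = ‖D x‖ₑ ^ 2 + ∫⁻ y, ‖D y‖ₑ ^ 2 ∂μ := fun x => by
    have h1 : ∀ y, ‖D x - D y‖ ^ 2 = ‖D x‖ ^ 2 - 2 * ⟪D x, D y⟫ + ‖D y‖ ^ 2 := fun y =>
      norm_sub_sq_real _ _
    have h2 : Integrable (fun y => ‖D x‖ ^ 2 - 2 * ⟪D x, D y⟫) μ :=
      (integrable_const _).sub ((hi.const_inner _).const_mul 2)
    simp only [hconv]
    rw [← ofReal_integral_eq_lintegral_ofReal, ← ofReal_integral_eq_lintegral_ofReal hsq,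
      ← ENNReal.ofReal_add (by positivity) (integral_nonneg fun y => by positivity)]
    · simp only [h1]
      rw [integral_add h2 hsq, integral_sub (integrable_const _) ((hi.const_inner _).const_mul 2),
        integral_const_mul, integral_inner hi, h0]
      simp
    · exact Eventually.of_forall fun y => by positivity
    · simp only [h1]
      exact h2.add hsq
    · exact Eventually.of_forall fun y => by positivity
  simp only [hinner]
  rw [lintegral_add_right _ measurable_const, lintegral_const, measure_univ, mul_one, two_mul]

end Coupling

/-! ### Averages along short segments. -/

section Segments

variable {E : Type*} [NormedAddCommGroup E] [InnerProductSpace ℝ E] [FiniteDimensional ℝ E]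
  [MeasurableSpace E] [BorelSpace E]

/-- For close pairs and `z` on the segment, `e^{-U x} e^{-U y} ≤ e^M e^{-U z}`, which trades the
product density for the density at `z`. With `w = x - y` fixed, translation invariance in `y` gives
`∫ F dμ` for every `t`; the integral over `w` contributes the volume of the ball. -/
theorem lintegral_segment_le {μ : Measure E} {U : E → ℝ} {R M : ℝ} (hU : Continuous U)
    (hμ : μ = volume.withDensity fun x => ENNReal.ofReal (Real.exp (-U x)))
    (hUM : ∀ x y, ‖x - y‖ ≤ 2 * R → ∀ z ∈ segment ℝ x y, U z - U x - U y ≤ M)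
    {F : E → ℝ≥0∞} (hF : Measurable F) :
    ∫⁻ p : E × E, (Metric.closedBall (0:E) (2 * R)).indicator 1 (p.1 - p.2) *
        (∫⁻ t in Set.Ioc (0:ℝ) 1, F (p.2 + t • (p.1 - p.2))) ∂μ.prod μ ≤
      ENNReal.ofReal (Real.exp M) * volume (Metric.closedBall (0:E) (2 * R)) * ∫⁻ x, F x ∂μ := by
  set ρ : E → ℝ≥0∞ := fun x => ENNReal.ofReal (Real.exp (-U x)) with hρ
  have hρm : Measurable ρ := by fun_prop
  set χ : E → ℝ≥0∞ := (Metric.closedBall (0:E) (2 * R)).indicator 1 with hχ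
  have hχm : Measurable χ := measurable_one.indicator measurableSet_closedBall
  set c := ENNReal.ofReal (Real.exp M)
  set I : E → E → ℝ≥0∞ := fun w y => ∫⁻ t in Set.Ioc (0:ℝ) 1, (ρ * F) (y + t • w) with hI
  have hρF : Measurable (ρ * F) := hρm.mul hF
  have hIm : Measurable fun q : E × E => I q.1 q.2 := by
    refine Measurable.lintegral_prod_right'
      (f := fun q : (E × E) × ℝ => (ρ * F) (q.1.2 + q.2 • q.1.1)) (hρF.comp ?_)
    fun_prop
  clear_value I
  have hFm : Measurable fun p : E × E =>
      ∫⁻ t in Set.Ioc (0:ℝ) 1, F (p.2 + t • (p.1 - p.2)) := by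
    refine Measurable.lintegral_prod_right'
      (f := fun q : (E × E) × ℝ => F (q.1.2 + q.2 • (q.1.1 - q.1.2))) (hF.comp ?_)
    fun_prop
  have hpt : ∀ x y : E, ρ x * ρ y * (χ (x - y) *
      ∫⁻ t in Set.Ioc (0:ℝ) 1, F (y + t • (x - y))) ≤ c * (χ (x - y) * I (x - y) y) := by
    intro x y
    by_cases hxy : x - y ∈ Metric.closedBall (0:E) (2 * R)
    · have hχ1 : χ (x - y) = 1 := Set.indicator_of_mem hxy _
      rw [hI, hχ1, one_mul, one_mul, ← lintegral_const_mul _ (by fun_prop),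
        ← lintegral_const_mul _ (by fun_prop)]
      refine setLIntegral_mono' measurableSet_Ioc fun t ht => ?_
      have hz : y + t • (x - y) ∈ segment ℝ x y := by
        rw [segment_symm, segment_eq_image']
        exact ⟨t, ⟨ht.1.le, ht.2⟩, rfl⟩
      have hb := hUM x y (by simpa using hxy) _ hz
      rw [Pi.mul_apply, ← mul_assoc]
      refine mul_le_mul_left ?_ _
      rw [hρ, ← ENNReal.ofReal_mul (Real.exp_pos _).le, ← ENNReal.ofReal_mul (Real.exp_pos _).le,
        ← Real.exp_add, ← Real.exp_add]
      exact ENNReal.ofReal_le_ofReal (Real.exp_le_exp.2 (by linarith))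
    · have hχ0 : χ (x - y) = 0 := Set.indicator_of_notMem hxy _
      simp [hχ0]
  have hprod : μ.prod μ = (volume.prod volume).withDensity fun p : E × E => ρ p.1 * ρ p.2 := by
    rw [hμ]
    exact prod_withDensity hρm hρm
  rw [hprod, lintegral_withDensity_eq_lintegral_mul _ (by fun_prop) (by fun_prop)]
  calc ∫⁻ p : E × E, ((fun p : E × E => ρ p.1 * ρ p.2) * fun p : E × E => χ (p.1 - p.2) *
        (∫⁻ t in Set.Ioc (0:ℝ) 1, F (p.2 + t • (p.1 - p.2)))) p ∂volume.prod volume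
      ≤ ∫⁻ p : E × E, c * (χ (p.1 - p.2) * I (p.1 - p.2) p.2) ∂volume.prod volume :=
        lintegral_mono fun p => hpt p.1 p.2
    _ = ∫⁻ y : E, ∫⁻ x : E, c * (χ (x - y) * I (x - y) y) := by
        rw [lintegral_prod_symm]
        have h1 : Measurable fun p : E × E => I (p.1 - p.2) p.2 :=
          hIm.comp (f := fun p : E × E => (p.1 - p.2, p.2)) (by fun_prop)
        fun_prop
    _ = ∫⁻ y : E, ∫⁻ w : E, c * (χ w * I w y) := by
        refine lintegral_congr fun y => ?_
        exact lintegral_sub_right_eq_self (fun w => c * (χ w * I w y)) y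
    _ = ∫⁻ w : E, ∫⁻ y : E, c * (χ w * I w y) := by
        refine lintegral_lintegral_swap ?_
        have h1 : Measurable fun p : E × E => I p.2 p.1 := hIm.comp measurable_swap
        refine Measurable.aemeasurable ?_
        unfold Function.uncurry
        fun_prop
    _ = ∫⁻ w : E, c * (χ w * ∫⁻ x, F x ∂μ) := by
        refine lintegral_congr fun w => ?_
        have hIw : Measurable (I w) := hIm.comp (f := fun y => (w, y)) (by fun_prop)
        rw [lintegral_const_mul _ (hIw.const_mul _), lintegral_const_mul _ hIw]
        congr 2
        simp only [hI]
        rw [lintegral_lintegral_swap]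
        · have h1 : ∀ t : ℝ, ∫⁻ y : E, (ρ * F) (y + t • w) = ∫⁻ x, F x ∂μ := fun t => by
            rw [lintegral_add_right_eq_self (ρ * F) (t • w), hμ,
              lintegral_withDensity_eq_lintegral_mul _ hρm hF]
          simp only [h1]
          simp
        · refine Measurable.aemeasurable (hρF.comp ?_)
          fun_prop
    _ = _ := by
        rw [lintegral_const_mul _ (hχm.mul_const _), lintegral_mul_const _ hχm, hχ,
          lintegral_indicator_one measurableSet_closedBall, mul_assoc]

end Segments

/-! ### Almost everywhere invertibility of the Hessian. -/

section CriticalPoints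

theorem ContinuousLinearMap.isUnit_of_det_ne_zero {E : Type*} [NormedAddCommGroup E]
    [NormedSpace ℝ E] [FiniteDimensional ℝ E] {A : E →L[ℝ] E} (h : A.det ≠ 0) : IsUnit A :=
  ⟨(ContinuousLinearEquiv.unitsEquiv ℝ E).symm (A.toContinuousLinearEquivOfDetNeZero h), by
    ext; rfl⟩

/-- A `C¹` map is a local diffeomorphism almost everywhere if it pushes `μ` forward to an absolutely
continuous measure. -/
theorem ae_isUnit_fderiv_of_map_absolutelyContinuous {E : Type*} [NormedAddCommGroup E]
    [InnerProductSpace ℝ E] [FiniteDimensional ℝ E] [MeasurableSpace E] [BorelSpace E]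
    {μ : Measure E} {T : E → E} (hT : ContDiff ℝ 1 T) (h : μ.map T ≪ volume) :
    ∀ᵐ x ∂μ, IsUnit (fderiv ℝ T x) := by
  set s := {x | (fderiv ℝ T x).det = 0} with hs
  have h0 : volume (T '' s) = 0 :=
    addHaar_image_eq_zero_of_det_fderivWithin_eq_zero volume
      (fun x _ => (hT.differentiable (by norm_num) x).hasFDerivAt.hasFDerivWithinAt)
      (fun x hx => hx)
  -- The image of the critical set is replaced by a measurable null superset in order to compute its
  -- mass under `μ.map T`.
  have h1 := h ((measure_toMeasurable (μ := volume) (T '' s)).trans h0)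
  rw [Measure.map_apply hT.continuous.measurable (measurableSet_toMeasurable _ _)] at h1
  refine measure_mono_null (fun x hx => ?_) h1
  refine subset_toMeasurable _ _ ⟨x, ?_, rfl⟩
  by_contra hx'
  exact hx (ContinuousLinearMap.isUnit_of_det_ne_zero hx')

end CriticalPoints

/-! ### The dissipation functional and the final estimate. -/

section Dissipation

theorem extIntegral_of_ae_nonneg {α : Type*} [MeasurableSpace α] {μ : Measure α} {f : α → ℝ}
    (hf : ∀ᵐ x ∂μ, 0 ≤ f x) :
    extIntegral μ f = ((∫⁻ x, ENNReal.ofReal (f x) ∂μ : ℝ≥0∞) : EReal) := by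
  have h : ∫⁻ x, ENNReal.ofReal (-f x) ∂μ = 0 := by
    rw [lintegral_congr_ae (g := fun _ => 0), lintegral_zero]
    filter_upwards [hf] with x hx
    simpa using hx
  rw [extIntegral, h]
  simp

theorem granConstant_pos (n : ℕ) {K : ℝ} (hK : 0 < K) (R M : ℝ) : 0 < granConstant n K R M := by
  unfold granConstant
  positivity

variable {n : ℕ} {φ W : EuclideanSpace ℝ (Fin n) → ℝ}

/-- The integrand of the interaction part of the dissipation. -/
noncomputable def interactionGap (W φ : EuclideanSpace ℝ (Fin n) → ℝ)
    (p : EuclideanSpace ℝ (Fin n) × EuclideanSpace ℝ (Fin n)) : ℝ :=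
  ⟪gradient W (gradient φ p.1 - gradient φ p.2) - gradient W (p.1 - p.2),
    gradient φ p.1 - gradient φ p.2 - (p.1 - p.2)⟫

theorem continuous_interactionGap (hW : ContDiff ℝ 2 W) (hφ : ContDiff ℝ 2 φ) :
    Continuous (interactionGap W φ) := by
  have h1 := hW.gradient_one.continuous
  have h2 := hφ.gradient_one.continuous
  unfold interactionGap
  fun_prop

/-- Both integrands are nonnegative a.e., so the negative parts vanish and the estimate can be
carried out in `ℝ≥0∞`, infinite values included. -/
theorem dissipationJ_zero_eq (hW : ContDiff ℝ 2 W) (hWc : ConvexOn ℝ Set.univ W)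
    (hφ : ContDiff ℝ 2 φ) (hc : ConvexOn ℝ Set.univ φ) {μ : Measure (EuclideanSpace ℝ (Fin n))}
    (hu : ∀ᵐ x ∂μ, IsUnit (fderiv ℝ (gradient φ) x)) :
    dissipationJ (fun _ => 0) W φ μ =
      ((∫⁻ x, ehessianGap (fderiv ℝ (gradient φ) x) ∂μ +
        ENNReal.ofReal (1 / 2) * ∫⁻ p, ENNReal.ofReal (interactionGap W φ p) ∂μ.prod μ : ℝ≥0∞) :
        EReal) := by
  have hg0 : ∀ z, gradient (fun _ : EuclideanSpace ℝ (Fin n) => (0:ℝ)) z = 0 := fun z => by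
    simp [gradient]
  have hval : ∀ᵐ x ∂μ, alexandrovLaplacian φ x + alexandrovLaplacian (legendre φ) (gradient φ x)
      - 2 * (n : ℝ) + ⟪gradient (fun _ : EuclideanSpace ℝ (Fin n) => (0:ℝ)) (gradient φ x) -
        gradient (fun _ : EuclideanSpace ℝ (Fin n) => (0:ℝ)) x, gradient φ x - x⟫ =
      hessianGap (fderiv ℝ (gradient φ) x) := by
    filter_upwards [hu] with x hx
    rw [alexandrovLaplacian_add_legendre hc hφ hx, hg0, hg0, sub_zero, inner_zero_left, add_zero]
  have hnn : ∀ᵐ x ∂μ, 0 ≤ hessianGap (fderiv ℝ (gradient φ) x) := by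
    filter_upwards [hu] with x hx
    refine (norm_sub_sq_le_hessianGap_mul_inner (isSymmetric_fderiv_gradient hφ x)
      (fun v => ?_) hx 0).1
    rw [inner_fderiv_gradient hφ]
    exact hc.fderiv_fderiv_nonneg hφ x v
  rw [dissipationJ, extIntegral_of_ae_nonneg, extIntegral_of_ae_nonneg]
  · have h1 : ((1 / 2 : ℝ) : EReal) = ((ENNReal.ofReal (1 / 2) : ℝ≥0∞) : EReal) := by
      rw [EReal.coe_ennreal_ofReal, max_eq_left (by norm_num)]
    rw [EReal.coe_ennreal_add, EReal.coe_ennreal_mul, h1]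
    congr 2
    refine lintegral_congr_ae ?_
    filter_upwards [hval, hu] with x hx hux
    rw [hx, ehessianGap, if_pos hux]
  · refine Eventually.of_forall fun p => ?_
    exact hWc.inner_gradient_sub_nonneg hW _ _
  · filter_upwards [hval, hnn] with x hx h0
    rwa [hx]

theorem enorm_displacement_sub_sq_le_gaps {K R : ℝ} (hK : 0 < K) (hW : ContDiff ℝ 2 W)
    (hWc : ConvexOn ℝ Set.univ W)
    (hWK : ∀ x, R ≤ ‖x‖ → ∀ v, K * ‖v‖ ^ 2 ≤ fderiv ℝ (fderiv ℝ W) x v v)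
    (hφ : ContDiff ℝ 2 φ) (hc : ConvexOn ℝ Set.univ φ)
    (p : EuclideanSpace ℝ (Fin n) × EuclideanSpace ℝ (Fin n)) :
    ‖(gradient φ p.1 - p.1) - (gradient φ p.2 - p.2)‖ₑ ^ 2 ≤
      ENNReal.ofReal (3 / K) * ENNReal.ofReal (interactionGap W φ p) +
      ENNReal.ofReal (4 * R ^ 2) *
        ((Metric.closedBall (0 : EuclideanSpace ℝ (Fin n)) (2 * R)).indicator 1 (p.1 - p.2) *
        ∫⁻ t in Set.Ioc (0:ℝ) 1,
          ehessianGap (fderiv ℝ (gradient φ) (p.2 + t • (p.1 - p.2)))) := by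
  by_cases hfar : 2 * R ≤ ‖gradient φ p.1 - gradient φ p.2‖ ∨ 2 * R ≤ ‖p.1 - p.2‖
  · refine le_add_right ?_
    have := inner_gradient_sub_ge_of_uniformly_convex_outside_ball hK.le hW hWc hWK hfar
    rw [sub_sub_sub_comm, ← ofReal_norm, ← ENNReal.ofReal_pow (norm_nonneg _),
      ← ENNReal.ofReal_mul (by positivity)]
    refine ENNReal.ofReal_le_ofReal ?_
    rw [interactionGap]
    calc _ = 3 / K * (K / 3 * ‖gradient φ p.1 - gradient φ p.2 - (p.1 - p.2)‖ ^ 2) := by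
          field_simp
      _ ≤ _ := by gcongr
  · push Not at hfar
    -- A pair at distance below `2R` forces `R > 0`, so the constant `4R²` is positive, as the
    -- segment estimate needs when its integral is infinite.
    have hR : 0 < R := by linarith [norm_nonneg (p.1 - p.2), hfar.2]
    refine le_add_left ?_
    have hmem : p.1 - p.2 ∈ Metric.closedBall (0 : EuclideanSpace ℝ (Fin n)) (2 * R) := by
      simpa using hfar.2.le
    rw [Set.indicator_of_mem hmem, Pi.one_apply, one_mul]
    refine enorm_displacement_sub_sq_le hφ hc (by positivity) ?_
    calc _ ≤ _ := real_inner_le_norm _ _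
      _ ≤ 2 * R * (2 * R) := by
        gcongr
        · exact hfar.1.le
        · exact hfar.2.le
      _ = _ := by ring

theorem granConstant_mul_W2_sq_le {K R M : ℝ} (hK : 0 < K) (hW : ContDiff ℝ 2 W)
    (hWc : ConvexOn ℝ Set.univ W)
    (hWK : ∀ x, R ≤ ‖x‖ → ∀ v, K * ‖v‖ ^ 2 ≤ fderiv ℝ (fderiv ℝ W) x v v)
    {μ : Measure (EuclideanSpace ℝ (Fin n))} {U : EuclideanSpace ℝ (Fin n) → ℝ} (hμ2 : IsP2 μ)
    (hU : Continuous U) (hμ : μ = volume.withDensity fun x => ENNReal.ofReal (Real.exp (-U x)))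
    (hUM : ∀ x y, ‖x - y‖ ≤ 2 * R → ∀ z ∈ segment ℝ x y, U z - U x - U y ≤ M)
    (hν2 : IsP2 (μ.map (gradient φ))) (hφ : ContDiff ℝ 2 φ) (hc : ConvexOn ℝ Set.univ φ)
    (hcenter : ∫ x, x ∂μ.map (gradient φ) = ∫ x, x ∂μ) :
    ENNReal.ofReal (granConstant n K R M) * W2 (μ.map (gradient φ)) μ ^ 2 ≤
      ∫⁻ x, ehessianGap (fderiv ℝ (gradient φ) x) ∂μ +
        ENNReal.ofReal (1 / 2) * ∫⁻ p, ENNReal.ofReal (interactionGap W φ p) ∂μ.prod μ := by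
  have : IsProbabilityMeasure μ := hμ2.1
  have hT : Continuous (gradient φ) := hφ.gradient_one.continuous
  have hTL : MemLp (gradient φ) 2 μ := by
    rw [memLp_two_iff_integrable_sq_norm hT.aestronglyMeasurable]
    exact (integrable_map_measure (by fun_prop) hT.aemeasurable).1 hν2.2
  have hidL : MemLp (fun x => x) 2 μ := by
    rw [memLp_two_iff_integrable_sq_norm (by fun_prop)]
    exact hμ2.2
  have hmean : ∫ x, (gradient φ x - x) ∂μ = 0 := by
    rw [integral_sub (hTL.integrable (by norm_num)) (hidL.integrable (by norm_num)), ← hcenter,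
      integral_map hT.aemeasurable (by fun_prop), sub_self]
  set B := volume (Metric.closedBall (0 : EuclideanSpace ℝ (Fin n)) (2 * R)) with hB
  set Ih := ∫⁻ x, ehessianGap (fderiv ℝ (gradient φ) x) ∂μ
  set Ig := ∫⁻ p, ENNReal.ofReal (interactionGap W φ p) ∂μ.prod μ
  have hBtop : B ≠ ⊤ := measure_closedBall_lt_top.ne
  -- The `6 / K` is twice the `3 / K` of the far pairs, since the interaction enters `J` with factor
  -- `1 / 2`. The variance identity supplies the `2` in `granConstant = 2 / c`.
  set c := 6 / K + 4 * R ^ 2 * B.toReal * Real.exp M with hcdef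
  have hc0 : 0 < c := by positivity
  have hFm : Measurable fun x => ehessianGap (fderiv ℝ (gradient φ) x) :=
    measurable_ehessianGap.comp (hφ.gradient_one.continuous_fderiv (by norm_num)).measurable
  have hvar := two_mul_lintegral_enorm_sq_eq_of_integral_eq_zero
    (hT.measurable.sub measurable_id) (hTL.sub hidL) hmean
  have hgm := (continuous_interactionGap hW hφ).measurable.ennreal_ofReal
  have hpair : 2 * ∫⁻ x, ‖gradient φ x - x‖ₑ ^ 2 ∂μ ≤
      ENNReal.ofReal c * (Ih + ENNReal.ofReal (1 / 2) * Ig) := by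
    calc _ = ∫⁻ p, ‖(gradient φ p.1 - p.1) - (gradient φ p.2 - p.2)‖ₑ ^ 2 ∂μ.prod μ := hvar
      _ ≤ _ := lintegral_mono fun p =>
        enorm_displacement_sub_sq_le_gaps hK hW hWc hWK hφ hc p
      _ ≤ ENNReal.ofReal (3 / K) * Ig +
          ENNReal.ofReal (4 * R ^ 2) * (ENNReal.ofReal (Real.exp M) * B * Ih) := by
        rw [lintegral_add_left (hgm.const_mul _), lintegral_const_mul _ hgm,
          lintegral_const_mul' _ _ ENNReal.ofReal_ne_top]
        gcongr
        exact lintegral_segment_le hU hμ hUM hFm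
      _ = ENNReal.ofReal (6 / K) * (ENNReal.ofReal (1 / 2) * Ig) +
          ENNReal.ofReal (4 * R ^ 2 * B.toReal * Real.exp M) * Ih := by
        rw [ENNReal.ofReal_mul (q := Real.exp M) (by positivity),
          ENNReal.ofReal_mul (q := B.toReal) (by positivity), ENNReal.ofReal_toReal hBtop, ← mul_assoc (ENNReal.ofReal (6 / K)),
          ← ENNReal.ofReal_mul (by positivity)]
        congr 1
        · congr 2
          ring
        · ring
      _ ≤ ENNReal.ofReal c * (ENNReal.ofReal (1 / 2) * Ig) + ENNReal.ofReal c * Ih := by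
        have h1 : 0 ≤ 6 / K := by positivity
        have h2 : 0 ≤ 4 * R ^ 2 * B.toReal * Real.exp M := by positivity
        gcongr <;> linarith
      _ = _ := by ring
  calc _ ≤ ENNReal.ofReal (granConstant n K R M) * ∫⁻ x, ‖gradient φ x - x‖ₑ ^ 2 ∂μ := by
        gcongr
        exact W2_map_sq_le hT.measurable
    _ = ENNReal.ofReal c⁻¹ * (2 * ∫⁻ x, ‖gradient φ x - x‖ₑ ^ 2 ∂μ) := by
        have h : granConstant n K R M = c⁻¹ * 2 := by rw [granConstant, hcdef, hB, mul_comm]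
        rw [h, ENNReal.ofReal_mul (by positivity), mul_assoc, ENNReal.ofReal_ofNat]
    _ ≤ ENNReal.ofReal c⁻¹ * (ENNReal.ofReal c * (Ih + ENNReal.ofReal (1 / 2) * Ig)) := by
        gcongr
    _ = _ := by
        rw [← mul_assoc, ← ENNReal.ofReal_mul (by positivity), inv_mul_cancel₀ hc0.ne',
          ENNReal.ofReal_one, one_mul]

end Dissipation

theorem mainTheorem2 (n : ℕ) (K R M : ℝ) (hK : 0 < K) :
    0 < granConstant n K R M ∧
    ∀ (W : EuclideanSpace ℝ (Fin n) → ℝ),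
      ContDiff ℝ 2 W →
      ConvexOn ℝ Set.univ W →
      (∀ x, R ≤ ‖x‖ → ∀ v, K * ‖v‖ ^ 2 ≤ fderiv ℝ (fderiv ℝ W) x v v) →
    ∀ (μ : Measure (EuclideanSpace ℝ (Fin n))) (U : EuclideanSpace ℝ (Fin n) → ℝ),
      IsP2 μ →
      Continuous U →
      μ = volume.withDensity (fun x => ENNReal.ofReal (Real.exp (-U x))) →
      (∀ x y, ‖x - y‖ ≤ 2 * R → ∀ z ∈ segment ℝ x y, U z - U x - U y ≤ M) →
    ∀ (ν : Measure (EuclideanSpace ℝ (Fin n))) (φ : EuclideanSpace ℝ (Fin n) → ℝ),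
      IsP2 ν →
      ν ≪ volume →
      IsBrenierPotential φ μ ν →
      ContDiff ℝ 2 φ →
      ∫ x, x ∂ν = ∫ x, x ∂μ →
      ((ENNReal.ofReal (granConstant n K R M) * W2 ν μ ^ 2 : ℝ≥0∞) : EReal)
        ≤ dissipationJ (fun _ => 0) W φ μ := by
  refine ⟨granConstant_pos n hK R M, ?_⟩
  rintro W hW hWc hWK μ U hμ2 hU hμ hUM _ φ hν2 hac ⟨hc, rfl⟩ hφ hcenter
  rw [dissipationJ_zero_eq hW hWc hφ hc
    (ae_isUnit_fderiv_of_map_absolutelyContinuous hφ.gradient_one hac)]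
  exact EReal.coe_ennreal_le_coe_ennreal_iff.2
    (granConstant_mul_W2_sq_le hK hW hWc hWK hμ2 hU hμ hUM hν2 hφ hc hcenter)
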